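/- Let $V=\{1,\dots,p\}$ and let $F:2^V\to\mathbb{R}$ be a submodular function with $F(\varnothing)=F(V)=0$. Let $f(w)=\int_{\mathbb{R}}F(\{k\in V: w_k\ge\alpha\})\,d\alpha$ be its Lovász extension on $\mathbb{R}^p$ and let $\lambda\ge 0$. A lattice $\mathcal{D}\subset 2^V$ is a family of sets containing $\varnothing$ and $V$ and stable under union and intersection. Its poset $\Pi(\mathcal{D})=\{A_1,\dots,A_m\}$ consists of the differences between consecutive sets of the maximal chains of $\mathcal{D}$; these sets form a partition of $V$, ordered so that $A_i$ is below $A_j$ if every set of $\mathcal{D}$ containing $A_j$ contains $A_i$. Consider the lattices $\mathcal{D}$ such that (i) $F(A)+F(B)=F(A\cup B)+F(A\cap B)$ for all $A,B\in\mathcal{D}$; (ii) for every $j$, with $B$ the union of the elements of $\Pi(\mathcal{D})$ strictly below $A_j$, the set $A_j$ is inseparable for $G(C)=F(B\cup C)-F(B)$, i.e. there is no partition of $A_j$ into two nonempty sets $C,C'$ with $G(A_j)=G(C)+G(C')$; (iii) $\mathcal{D}$ is maximal for inclusion among the lattices with the same unordered partition that satisfy (i) and (ii). For every $z\in\mathbb{R}^p$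 the problem $\min_{w\in\mathbb{R}^p}\frac12\|w-z\|_2^2+\lambda f(w)$ has a unique minimizer. If $z$ is a random vector in $\mathbb{R}^p$ whose law is absolutely continuous with respect to the Lebesgue measure, then, with probability one, the unique minimizer $\hat w$ satisfies the following: there is a lattice $\mathcal{D}$ satisfying (i), (ii) and (iii) such that $\hat w$ is constant on each $A_j\in\Pi(\mathcal{D})$, with value $v_j$, such that $v_i>v_j$ whenever $A_i$ is strictly below $A_j$, and such that the (nonempty) constant sets $\{k\in V:\hat w_k=\alpha\}$ of $\hat w$ are exactly the elements of $\Pi(\mathcal{D})$. -/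

import Mathlib

open MeasureTheory

namespace LovaszProx

variable {p : ℕ}

/-- `F` is submodular on the power set of `V = Fin p`. -/
def Submodular (F : Finset (Fin p) → ℝ) : Prop :=
  ∀ A B, F (A ∪ B) + F (A ∩ B) ≤ F A + F B

/-- The level set `{w ≥ α}`. -/
noncomputable def levelSet (w : EuclideanSpace ℝ (Fin p)) (α : ℝ) : Finset (Fin p) :=
  Finset.univ.filter fun k => α ≤ w k

/-- The Lovász extension `f(w) = ∫ F({w ≥ α}) dα` of a set function with
`F(∅) = F(V) = 0` (the integrand is then a step function with bounded support). -/
noncomputable def lovasz (F : Finset (Fin p) → ℝ) (w : EuclideanSpace ℝ (Fin p)) : ℝ :=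
  ∫ α : ℝ, F (levelSet w α)

/-- The proximal objective `½ ‖w - z‖₂² + t f(w)` with regularization parameter `t`. -/
noncomputable def proxObjective (F : Finset (Fin p) → ℝ) (t : ℝ)
    (z w : EuclideanSpace ℝ (Fin p)) : ℝ :=
  1 / 2 * ‖w - z‖ ^ 2 + t * lovasz F w

/-- The (nonempty) constant sets `{w = α}` of `w`. -/
def constantSets (w : EuclideanSpace ℝ (Fin p)) : Set (Finset (Fin p)) :=
  {S | S.Nonempty ∧ ∃ α : ℝ, ∀ k, k ∈ S ↔ w k = α}

/-- A lattice of subsets of `V`: stable under union and intersection, containing `∅` and `V`. -/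
structure IsSetLattice (D : Set (Finset (Fin p))) : Prop where
  empty_mem : ∅ ∈ D
  univ_mem : Finset.univ ∈ D
  union_mem : ∀ A ∈ D, ∀ B ∈ D, A ∪ B ∈ D
  inter_mem : ∀ A ∈ D, ∀ B ∈ D, A ∩ B ∈ D

/-- `A` and `B` are consecutive in (some maximal chain of) `D`. -/
def Consecutive (D : Set (Finset (Fin p))) (A B : Finset (Fin p)) : Prop :=
  A ∈ D ∧ B ∈ D ∧ A ⊂ B ∧ ∀ C ∈ D, A ⊆ C → C ⊆ B → C = A ∨ C = B

/-- The elements of the poset `Π(D)`: the differences of consecutive sets of the maximal chains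
of `D`. -/
def blocks (D : Set (Finset (Fin p))) : Set (Finset (Fin p)) :=
  {S | ∃ A B, Consecutive D A B ∧ S = B \ A}

/-- The order of `Π(D)`, under which the sets of `D` are the unions of the ideals (lower sets) of
`Π(D)`: `A'` is lower than or equal to `A` when each set of `D` that contains `A` contains
`A'`. -/
def Below (D : Set (Finset (Fin p))) (A' A : Finset (Fin p)) : Prop :=
  ∀ X ∈ D, A ⊆ X → A' ⊆ X

/-- The union of the elements of `Π(D)` strictly below `A` (the ancestors of `A`). -/
noncomputable def ancestors (D : Set (Finset (Fin p))) (A : Finset (Fin p)) : Finset (Fin p) :=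
  open scoped Classical in
  Finset.univ.filter fun k => ∃ A' ∈ blocks D, A' ≠ A ∧ Below D A' A ∧ k ∈ A'

/-- `A` is separable for `G` if `G(A) = G(B) + G(C)` for a nontrivial partition `A = B ∪ C`;
inseparable otherwise. -/
def Inseparable (G : Finset (Fin p) → ℝ) (A : Finset (Fin p)) : Prop :=
  ¬ ∃ B C : Finset (Fin p), B.Nonempty ∧ C.Nonempty ∧ Disjoint B C ∧ B ∪ C = A ∧
    G A = G B + G C

/-- The restriction of `F` to `D` is modular. -/
def ModularOn (F : Finset (Fin p) → ℝ) (D : Set (Finset (Fin p))) : Prop :=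
  ∀ A ∈ D, ∀ B ∈ D, F A + F B = F (A ∪ B) + F (A ∩ B)

/-- Each element `A` of `Π(D)`, with `B` the union of its ancestors, is inseparable for
`C ↦ F(B ∪ C) - F(B)`. -/
def BlocksInseparable (F : Finset (Fin p) → ℝ) (D : Set (Finset (Fin p))) : Prop :=
  ∀ A ∈ blocks D, Inseparable (fun C => F (ancestors D A ∪ C) - F (ancestors D A)) A

/-- The lattices that characterize the faces of the unit ball `{f ≤ 1}`: `D` satisfies the
modularity and the inseparability conditions and is maximal, for inclusion, among the lattices
with the same unordered partition that satisfy both. -/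
def IsFaceLattice (F : Finset (Fin p) → ℝ) (D : Set (Finset (Fin p))) : Prop :=
  Maximal (fun D' => IsSetLattice D' ∧ blocks D' = blocks D ∧ ModularOn F D' ∧
    BlocksInseparable F D') D

/-- The cone attached to `D`: the vectors which are constant on each element of `Π(D)` and whose
value on an element is strictly smaller than on each element strictly below it (so that the
level sets `{w ≥ α}` belong to `D`). -/
def openFaceCone (D : Set (Finset (Fin p))) : Set (EuclideanSpace ℝ (Fin p)) :=
  {w | (∀ A ∈ blocks D, ∀ k ∈ A, ∀ l ∈ A, w k = w l) ∧
    ∀ A' ∈ blocks D, ∀ A ∈ blocks D, A' ≠ A → Below D A' A → ∀ k ∈ A', ∀ l ∈ A, w l < w k}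

/-- The elements of `Π(D)` are the classes of indices that no set of `D` separates. -/
theorem mem_blocks_iff {D : Set (Finset (Fin p))} (hD : IsSetLattice D) (S : Finset (Fin p)) :
    S ∈ blocks D ↔ ∃ k, ∀ l, l ∈ S ↔ ∀ X ∈ D, (k ∈ X ↔ l ∈ X) := by
  classical
  constructor
  · rintro ⟨A, B, ⟨hA, hB, hAB, hmax⟩, rfl⟩
    obtain ⟨k, hkB, hkA⟩ := Finset.exists_of_ssubset hAB
    have key : ∀ l, l ∈ B → l ∉ A → ∀ X ∈ D, l ∈ X → B ⊆ A ∪ X := by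
      intro l hlB hlA X hX hlX
      have hC : A ∪ (X ∩ B) ∈ D := hD.union_mem _ hA _ (hD.inter_mem _ hX _ hB)
      rcases hmax _ hC Finset.subset_union_left
        (Finset.union_subset hAB.subset Finset.inter_subset_right) with h | h
      · exact absurd (h ▸ (by simp [hlX, hlB] : l ∈ A ∪ (X ∩ B))) hlA
      · intro m hm
        rw [← h] at hm
        simp only [Finset.mem_union, Finset.mem_inter] at hm ⊢
        tauto
    refine ⟨k, fun l => ⟨fun hl X hX => ?_, fun h => ?_⟩⟩
    · obtain ⟨hlB, hlA⟩ := Finset.mem_sdiff.1 hl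
      constructor
      · intro hkX
        have := key k hkB hkA X hX hkX hlB
        simp only [Finset.mem_union] at this
        tauto
      · intro hlX
        have := key l hlB hlA X hX hlX hkB
        simp only [Finset.mem_union] at this
        tauto
    · exact Finset.mem_sdiff.2 ⟨(h B hB).1 hkB, fun hl => hkA ((h A hA).2 hl)⟩
  · rintro ⟨k, hk⟩
    -- `B` is the smallest set of `D` that contains `k`, `A` the largest one in `B` without `k`
    obtain ⟨B, ⟨hB, hkB⟩, hBmin⟩ := (Set.toFinite {X | X ∈ D ∧ k ∈ X}).exists_minimal
      ⟨Finset.univ, hD.univ_mem, Finset.mem_univ k⟩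
    obtain ⟨A, ⟨hA, hkA, hAB⟩, hAmax⟩ := (Set.toFinite {X | X ∈ D ∧ k ∉ X ∧ X ⊆ B}).exists_maximal
      ⟨∅, hD.empty_mem, by simp, by simp⟩
    have hBle : ∀ X ∈ D, k ∈ X → B ⊆ X := fun X hX hkX =>
      (hBmin ⟨hD.inter_mem _ hB _ hX, by simp [hkB, hkX]⟩ Finset.inter_subset_left).trans
        Finset.inter_subset_right
    have hAge : ∀ X ∈ D, k ∉ X → X ⊆ B → X ⊆ A := fun X hX hkX hXB =>
      Finset.subset_union_right.trans
        (hAmax ⟨hD.union_mem _ hA _ hX, by simp [hkA, hkX], Finset.union_subset hAB hXB⟩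
          Finset.subset_union_left)
    refine ⟨A, B, ⟨hA, hB, ⟨hAB, fun h => hkA (h hkB)⟩, fun C hC hAC hCB => ?_⟩, ?_⟩
    · by_cases hkC : k ∈ C
      · exact Or.inr (hCB.antisymm (hBle C hC hkC))
      · exact Or.inl ((hAge C hC hkC hCB).antisymm hAC)
    · ext l
      rw [hk, Finset.mem_sdiff]
      refine ⟨fun h => ⟨(h B hB).1 hkB, fun hl => hkA ((h A hA).2 hl)⟩, ?_⟩
      rintro ⟨hlB, hlA⟩ X hX
      refine ⟨fun hkX => hBle X hX hkX hlB, fun hlX => ?_⟩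
      by_contra hkX
      exact hlA (hAge (X ∩ B) (hD.inter_mem _ hX _ hB) (by simp [hkX])
        Finset.inter_subset_right (by simp [hlX, hlB]))

end LovaszProx

/-!
Moving a minimizer `ŵ` up or down along the indicator vector of a part of one of its constant sets
`{ŵ = α}` changes the Lovász extension linearly, and optimality gives, with `B = {ŵ > α}` and
`G(C) = F(B ∪ C) - F(B)`, the inequalities `∑_{k ∈ C} (z_k - α) ≤ t G(C)` for `C ⊆ {ŵ = α}`, and the
reverse one for `C = {ŵ = α}`. If `{ŵ = α}` were separable into `C` and `C'`, the inequalities for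
`C` and `C'` would be equalities, and eliminating `α` would put `z` on one of finitely many
hyperplanes, which are all Lebesgue-null. Hence, for almost every `z`, the chain of the level sets
of `ŵ` is a lattice that satisfies (i) and (ii), and a maximal lattice with the same partition above
it is the one sought. Uniqueness comes from the convexity of `f`, the maximum of the linear forms
given by the bases of `F`.
-/

namespace LovaszProx

open Filter Topology

theorem convexOn_univ_of_forall_exists_linear_le {E : Type*} [AddCommGroup E] [Module ℝ E]
    {f : E → ℝ} (hf : ∀ x, ∃ L : E →ₗ[ℝ] ℝ, L x = f x ∧ ∀ y, L y ≤ f y) :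
    ConvexOn ℝ Set.univ f := by
  refine ⟨convex_univ, fun x _ y _ a b ha hb _ => ?_⟩
  obtain ⟨L, hL, hLf⟩ := hf (a • x + b • y)
  rw [← hL, map_add, map_smul, map_smul]
  gcongr
  exacts [hLf x, hLf y]

section InnerProductSpace

variable {E : Type*} [NormedAddCommGroup E]

theorem exists_isMinOn_half_norm_sub_sq_add [ProperSpace E] {g : E → ℝ} (hg : Continuous g) {K : ℝ}
    (hK : ∀ x, -(K * ‖x‖) ≤ g x) (z : E) :
    ∃ x, IsMinOn (fun x => 1 / 2 * ‖x - z‖ ^ 2 + g x) Set.univ x := by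
  have hlower : ∀ x, ‖x‖ + -((K + 1) ^ 2 / 2 + (K + 1) * ‖z‖) ≤ 1 / 2 * ‖x - z‖ ^ 2 + g x := by
    intro x
    have hsq : (‖x‖ - ‖z‖) ^ 2 ≤ ‖x - z‖ ^ 2 :=
      sq_le_sq.2 (by simpa using abs_norm_sub_norm_le x z)
    nlinarith [hK x, sq_nonneg (‖x‖ - ‖z‖ - (K + 1))]
  have hcoercive : Tendsto (fun x => 1 / 2 * ‖x - z‖ ^ 2 + g x) (cocompact E) atTop :=
    tendsto_atTop_mono hlower
      (tendsto_atTop_add_const_right _ _ tendsto_norm_cocompact_atTop)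
  obtain ⟨x, hx⟩ := Continuous.exists_forall_le (by fun_prop) hcoercive
  exact ⟨x, fun y _ => hx y⟩

variable [InnerProductSpace ℝ E]

theorem strictConvexOn_half_norm_sub_sq_add {s : Set E} {g : E → ℝ} (hg : ConvexOn ℝ s g) (z : E) :
    StrictConvexOn ℝ s fun x => 1 / 2 * ‖x - z‖ ^ 2 + g x := by
  suffices h : ConvexOn ℝ s fun x => 1 / 2 * ‖x - z‖ ^ 2 + g x - 1 / 2 * ‖x‖ ^ 2 from
    (strongConvexOn_iff_convex.2 h).strictConvexOn one_pos
  have haffine : ConvexOn ℝ s fun x => innerₛₗ ℝ (-z) x + 1 / 2 * ‖z‖ ^ 2 :=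
    ((innerₛₗ ℝ (-z)).convexOn hg.1).add_const _
  refine (haffine.add hg).congr fun x _ => ?_
  simp only [Pi.add_apply, innerₛₗ_apply_apply, inner_neg_left, norm_sub_sq_real,
    real_inner_comm x z]
  ring

theorem inner_sub_le_of_isMinOn {g : E → ℝ} {z x v : E} {d : ℝ}
    (hx : IsMinOn (fun x => 1 / 2 * ‖x - z‖ ^ 2 + g x) Set.univ x)
    (hg : ∀ᶠ c : ℝ in 𝓝[>] 0, g (x + c • v) = g x + c * d) : inner ℝ (z - x) v ≤ d := by
  have hlim : Tendsto (fun c : ℝ => d + c * (1 / 2 * ‖v‖ ^ 2)) (𝓝[>] 0) (𝓝 d) := by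
    refine tendsto_nhdsWithin_of_tendsto_nhds ?_
    simpa using (by fun_prop : Continuous fun c : ℝ => d + c * (1 / 2 * ‖v‖ ^ 2)).tendsto 0
  refine ge_of_tendsto hlim ?_
  filter_upwards [hg, self_mem_nhdsWithin] with c hgc (hc : 0 < c)
  have hmin : 1 / 2 * ‖x - z‖ ^ 2 + g x ≤ 1 / 2 * ‖x + c • v - z‖ ^ 2 + g (x + c • v) :=
    hx (Set.mem_univ _)
  rw [hgc, add_sub_right_comm, norm_add_sq_real, norm_smul, inner_smul_right, mul_pow,
    Real.norm_eq_abs, sq_abs, ← neg_sub z x, inner_neg_left, norm_neg] at hmin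
  refine le_of_mul_le_mul_left ?_ hc
  linarith

theorem ae_inner_ne [FiniteDimensional ℝ E] [MeasurableSpace E] [BorelSpace E] (μ : Measure E)
    [μ.IsAddHaarMeasure] {v : E} (hv : v ≠ 0) (c : ℝ) : ∀ᵐ z ∂μ, inner ℝ v z ≠ c := by
  have hsurj : Function.Surjective (innerₛₗ ℝ v) :=
    LinearMap.surjective fun h => hv (inner_self_eq_zero.1 (LinearMap.congr_fun h v))
  exact (ae_comp_linearMap_mem_iff (innerₛₗ ℝ v) μ volume hsurj
    (measurableSet_singleton c).compl).2 (Measure.ae_ne volume c)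

end InnerProductSpace

theorem eventually_forall_lt_imp_add_le {ι : Type*} [Finite ι] (u : ι → ℝ) (α : ℝ) :
    ∀ᶠ c in 𝓝[>] 0, ∀ k, α < u k → α + c ≤ u k := by
  refine eventually_all.2 fun k => ?_
  by_cases hk : α < u k
  · filter_upwards [nhdsWithin_le_nhds (Iic_mem_nhds (sub_pos.2 hk))] with c hc _
    linarith [Set.mem_Iic.1 hc]
  · exact Eventually.of_forall fun c h => absurd h hk

section IndicatorVector

variable {ι : Type*}

/-- The indicator vector `1_C` of a set `C` of coordinates. -/
noncomputable def indicatorVec (C : Finset ι) : EuclideanSpace ℝ ι :=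
  WithLp.toLp 2 ((C : Set ι).indicator 1)

theorem indicatorVec_apply_of_mem {C : Finset ι} {k : ι} (hk : k ∈ C) : indicatorVec C k = 1 :=
  Set.indicator_of_mem (Finset.mem_coe.2 hk) _

theorem indicatorVec_apply_of_notMem {C : Finset ι} {k : ι} (hk : k ∉ C) :
    indicatorVec C k = 0 :=
  Set.indicator_of_notMem (mt Finset.mem_coe.1 hk) _

theorem add_smul_indicatorVec_apply [DecidableEq ι] (x : EuclideanSpace ℝ ι) (c : ℝ) (C : Finset ι)
    (k : ι) : (x + c • indicatorVec C) k = if k ∈ C then x k + c else x k := by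
  split_ifs with hk
  · simp [indicatorVec_apply_of_mem hk]
  · simp [indicatorVec_apply_of_notMem hk]

/-- The vector `|C'| 1_C - |C| 1_C'`: the comparison of the means over `C` and over `C'`, cleared
of denominators. -/
noncomputable def contrast (C C' : Finset ι) : EuclideanSpace ℝ ι :=
  (C'.card : ℝ) • indicatorVec C - (C.card : ℝ) • indicatorVec C'

theorem contrast_ne_zero {C C' : Finset ι} (hC : C.Nonempty) (hC' : C'.Nonempty)
    (hdisj : Disjoint C C') : contrast C C' ≠ 0 := by
  obtain ⟨k, hk⟩ := hC
  intro h
  have hcard : contrast C C' k = C'.card := by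
    simp [contrast, indicatorVec_apply_of_mem hk,
      indicatorVec_apply_of_notMem (Finset.disjoint_left.1 hdisj hk)]
  rw [h, PiLp.zero_apply] at hcard
  exact hC'.card_ne_zero (Nat.cast_eq_zero.1 hcard.symm)

variable [Fintype ι]

theorem inner_indicatorVec_right (x : EuclideanSpace ℝ ι) (C : Finset ι) :
    inner ℝ x (indicatorVec C) = ∑ k ∈ C, x k := by
  classical
  simp [PiLp.inner_apply, indicatorVec, Set.indicator_apply]

theorem inner_contrast (C C' : Finset ι) (z : EuclideanSpace ℝ ι) :
    inner ℝ (contrast C C') z = C'.card * ∑ k ∈ C, z k - C.card * ∑ k ∈ C', z k := by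
  rw [real_inner_comm, contrast, inner_sub_right, real_inner_smul_right, real_inner_smul_right,
    inner_indicatorVec_right, inner_indicatorVec_right]

end IndicatorVector

variable {p : ℕ} {F : Finset (Fin p) → ℝ} {w z : EuclideanSpace ℝ (Fin p)} {α t : ℝ}

/-- The strict level set `{w > α}`. -/
noncomputable def strictLevelSet (w : EuclideanSpace ℝ (Fin p)) (α : ℝ) : Finset (Fin p) :=
  Finset.univ.filter fun k => α < w k

/-- The possibly empty constant set `{w = α}`. -/
noncomputable def constantSet (w : EuclideanSpace ℝ (Fin p)) (α : ℝ) : Finset (Fin p) :=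
  Finset.univ.filter fun k => w k = α

@[simp]
theorem mem_levelSet {k : Fin p} : k ∈ levelSet w α ↔ α ≤ w k := by simp [levelSet]

@[simp]
theorem mem_strictLevelSet {k : Fin p} : k ∈ strictLevelSet w α ↔ α < w k := by
  simp [strictLevelSet]

@[simp]
theorem mem_constantSet {k : Fin p} : k ∈ constantSet w α ↔ w k = α := by simp [constantSet]

theorem strictLevelSet_union_constantSet :
    strictLevelSet w α ∪ constantSet w α = levelSet w α := by
  ext k
  simp [le_iff_lt_or_eq, eq_comm]

theorem mem_constantSets_iff {S : Finset (Fin p)} :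
    S ∈ constantSets w ↔ ∃ α, (constantSet w α).Nonempty ∧ S = constantSet w α := by
  constructor
  · rintro ⟨hne, α, hα⟩
    obtain rfl : S = constantSet w α := by ext k; simp [hα]
    exact ⟨α, hne, rfl⟩
  · rintro ⟨α, hne, rfl⟩
    exact ⟨hne, α, fun k => mem_constantSet⟩

theorem measurable_comp_levelSet (F : Finset (Fin p) → ℝ) (w : EuclideanSpace ℝ (Fin p)) :
    Measurable fun β => F (levelSet w β) := by
  let _ : MeasurableSpace (Finset (Fin p)) := ⊤
  have hlevel : Measurable (levelSet w) := by
    refine measurable_to_countable' fun S => ?_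
    have hpre : levelSet w ⁻¹' {S} = ⋂ k, {β | β ≤ w k ↔ k ∈ S} := by
      ext β
      simp [Finset.ext_iff]
    rw [hpre]
    exact MeasurableSet.iInter fun k => measurableSet_Iic.iff (MeasurableSet.const _)
  exact (measurable_from_top : Measurable F).comp hlevel

theorem support_comp_levelSet_subset (hF_empty : F ∅ = 0) (hF_univ : F Finset.univ = 0) {R : ℝ}
    (hR : ‖w‖ ≤ R) : (Function.support fun β => F (levelSet w β)) ⊆ Set.Ioc (-R) R := by
  have hcoord : ∀ k, |w k| ≤ R := fun k => (PiLp.norm_apply_le w k).trans hR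
  intro β hβ
  by_contra hout
  apply hβ
  change F (levelSet w β) = 0
  rcases le_or_gt β (-R) with h | h
  · rw [show levelSet w β = Finset.univ by ext k; simpa using h.trans (abs_le.1 (hcoord k)).1,
      hF_univ]
  · have hRβ : R < β := not_le.1 fun hle => hout ⟨h, hle⟩
    rw [show levelSet w β = ∅ by ext k; simpa using (abs_le.1 (hcoord k)).2.trans_lt hRβ,
      hF_empty]

theorem lovasz_eq_intervalIntegral (hF_empty : F ∅ = 0) (hF_univ : F Finset.univ = 0) {R : ℝ}
    (hR : ‖w‖ ≤ R) : lovasz F w = ∫ β in (-R)..R, F (levelSet w β) :=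
  (intervalIntegral.integral_eq_integral_of_support_subset
    (support_comp_levelSet_subset hF_empty hF_univ hR)).symm

theorem integrable_comp_levelSet (hF_empty : F ∅ = 0) (hF_univ : F Finset.univ = 0)
    (w : EuclideanSpace ℝ (Fin p)) : Integrable fun β => F (levelSet w β) := by
  obtain ⟨M, hM⟩ := Finite.exists_le fun A => |F A|
  rw [← integrableOn_iff_integrable_of_support_subset
    (support_comp_levelSet_subset hF_empty hF_univ le_rfl)]
  exact Measure.integrableOn_of_bounded measure_Ioc_lt_top.ne
    (measurable_comp_levelSet F w).aestronglyMeasurable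
    (Eventually.of_forall fun β => hM (levelSet w β))

theorem exists_forall_abs_lovasz_le (hF_empty : F ∅ = 0) (hF_univ : F Finset.univ = 0) :
    ∃ K, ∀ w, |lovasz F w| ≤ K * ‖w‖ := by
  obtain ⟨M, hM⟩ := Finite.exists_le fun A => |F A|
  refine ⟨2 * M, fun w => ?_⟩
  rw [lovasz_eq_intervalIntegral hF_empty hF_univ le_rfl]
  calc ‖∫ β in (-‖w‖)..‖w‖, F (levelSet w β)‖
      ≤ M * |‖w‖ - -‖w‖| :=
        intervalIntegral.norm_integral_le_of_norm_le_const fun β _ => hM (levelSet w β)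
    _ = 2 * M * ‖w‖ := by rw [sub_neg_eq_add, ← two_mul, abs_of_nonneg (by positivity)]; ring

theorem eventually_levelSet_eq {β : ℝ} (hβ : ∀ k, β ≠ w k) :
    ∀ᶠ x in 𝓝 w, levelSet x β = levelSet w β := by
  have hcoord : ∀ k, ∀ᶠ x : EuclideanSpace ℝ (Fin p) in 𝓝 w, β ≤ x k ↔ β ≤ w k := by
    intro k
    have hcont : Tendsto (fun x : EuclideanSpace ℝ (Fin p) => x k) (𝓝 w) (𝓝 (w k)) :=
      (EuclideanSpace.proj (𝕜 := ℝ) k).continuous.tendsto w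
    rcases (hβ k).lt_or_gt with h | h
    · filter_upwards [hcont.eventually_const_lt h] with x hx
      exact iff_of_true hx.le h.le
    · filter_upwards [hcont.eventually_lt_const h] with x hx
      exact iff_of_false hx.not_ge h.not_ge
  filter_upwards [eventually_all.2 hcoord] with x hx
  ext k
  simpa using hx k

theorem continuous_lovasz (hF_empty : F ∅ = 0) (hF_univ : F Finset.univ = 0) :
    Continuous (lovasz F) := by
  obtain ⟨M, hM⟩ := Finite.exists_le fun A => |F A|
  refine continuous_iff_continuousAt.2 fun w => ?_
  have hnear : ∀ᶠ x in 𝓝 w, ‖x‖ ≤ ‖w‖ + 1 :=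
    (continuous_norm.tendsto w).eventually_le_const (lt_add_one ‖w‖)
  have hlocal : (fun x => ∫ β in (-(‖w‖ + 1))..(‖w‖ + 1), F (levelSet x β)) =ᶠ[𝓝 w] lovasz F := by
    filter_upwards [hnear] with x hx
    exact (lovasz_eq_intervalIntegral hF_empty hF_univ hx).symm
  refine ContinuousAt.congr ?_ hlocal
  refine intervalIntegral.continuousAt_of_dominated_interval (bound := fun _ => M)
    (Eventually.of_forall fun x => (measurable_comp_levelSet F x).aestronglyMeasurable)
    (Eventually.of_forall fun x => Eventually.of_forall fun β _ => hM (levelSet x β))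
    intervalIntegrable_const ?_
  filter_upwards [ae_all_iff.2 fun k => Measure.ae_ne volume (w k)] with β hβ _
  refine tendsto_const_nhds.congr' ?_
  filter_upwards [eventually_levelSet_eq hβ] with x hx
  rw [hx]

theorem exists_isMinOn_proxObjective (hF_empty : F ∅ = 0) (hF_univ : F Finset.univ = 0) (t : ℝ)
    (z : EuclideanSpace ℝ (Fin p)) : ∃ w, IsMinOn (proxObjective F t z) Set.univ w := by
  obtain ⟨K, hK⟩ := exists_forall_abs_lovasz_le hF_empty hF_univ
  refine exists_isMinOn_half_norm_sub_sq_add (K := |t| * K)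
    ((continuous_lovasz hF_empty hF_univ).const_mul t) (fun w => neg_le_of_abs_le ?_) z
  rw [abs_mul, mul_assoc]
  exact mul_le_mul_of_nonneg_left (hK w) (abs_nonneg t)

theorem lovasz_mono {G : Finset (Fin p) → ℝ} (hF_empty : F ∅ = 0) (hF_univ : F Finset.univ = 0)
    (hG_empty : G ∅ = 0) (hG_univ : G Finset.univ = 0) (hFG : ∀ A, F A ≤ G A)
    (w : EuclideanSpace ℝ (Fin p)) : lovasz F w ≤ lovasz G w :=
  integral_mono (integrable_comp_levelSet hF_empty hF_univ w)
    (integrable_comp_levelSet hG_empty hG_univ w) fun β => hFG (levelSet w β)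

theorem integral_indicator_Iic_one {a R : ℝ} (ha : |a| ≤ R) :
    ∫ β in (-R)..R, (Set.Iic a).indicator 1 β = a + R := by
  rw [← Set.Iic_def, intervalIntegral.integral_indicator (abs_le.1 ha)]
  simp

theorem lovasz_sum_eq {s : Fin p → ℝ} (hs : ∑ k, s k = 0) (w : EuclideanSpace ℝ (Fin p)) :
    lovasz (fun A => ∑ k ∈ A, s k) w = ∑ k, s k * w k := by
  have hlayer : ∀ β, ∑ k ∈ levelSet w β, s k = ∑ k, s k * (Set.Iic (w k)).indicator 1 β :=
    fun β => by simp [levelSet, Finset.sum_filter, Set.indicator_apply]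
  have hint : ∀ k, IntervalIntegrable (fun β => s k * (Set.Iic (w k)).indicator 1 β)
      volume (-‖w‖) ‖w‖ := fun k =>
    IntervalIntegrable.const_mul ⟨(integrableOn_const measure_Ioc_lt_top.ne).indicator
      measurableSet_Iic, (integrableOn_const measure_Ioc_lt_top.ne).indicator measurableSet_Iic⟩ _
  rw [lovasz_eq_intervalIntegral Finset.sum_empty hs le_rfl]
  simp only [hlayer]
  rw [intervalIntegral.integral_finsetSum fun k _ => hint k]
  simp only [intervalIntegral.integral_const_mul,
    integral_indicator_Iic_one (PiLp.norm_apply_le w _), mul_add, Finset.sum_add_distrib,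
    ← Finset.sum_mul, hs, zero_mul, add_zero]

/-- `s` is a base of the restriction of `F` to the subsets of `S`: the modular function of `s` is
dominated by `F` and agrees with it on `S`. -/
def IsBase (F : Finset (Fin p) → ℝ) (S : Finset (Fin p)) (s : Fin p → ℝ) : Prop :=
  (∀ A ⊆ S, ∑ k ∈ A, s k ≤ F A) ∧ ∑ k ∈ S, s k = F S

theorem IsBase.update_insert {S : Finset (Fin p)} {s : Fin p → ℝ} (hs : IsBase F S s)
    (hF : Submodular F) {a : Fin p} (ha : a ∉ S) :
    IsBase F (insert a S) (Function.update s a (F (insert a S) - F S)) := by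
  refine ⟨fun A hA => ?_, by rw [Finset.sum_insert ha, Finset.sum_update_of_notMem ha, hs.2,
    Function.update_self, sub_add_cancel]⟩
  by_cases haA : a ∈ A
  · have hsub : A.erase a ⊆ S := Finset.subset_insert_iff.1 hA
    have hunion : A ∪ S = insert a S := by grind
    have hinter : A ∩ S = A.erase a := by grind
    have hsubmod : F (insert a S) + F (A.erase a) ≤ F A + F S := hunion ▸ hinter ▸ hF A S
    rw [← Finset.add_sum_erase A _ haA, Finset.sum_update_of_notMem (Finset.notMem_erase a A),
      Function.update_self]
    linarith [hs.1 _ hsub]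
  · rw [Finset.sum_update_of_notMem haA]
    exact hs.1 A ((Finset.subset_insert_iff_of_notMem haA).1 hA)

/- Edmonds' greedy algorithm: the elements are inserted by decreasing value of `w`, each receiving
its marginal value, so that every level set is an initial segment of the insertion order. -/
theorem exists_isBase_tight_on_levelSets (hF : Submodular F) (hF_empty : F ∅ = 0)
    (w : EuclideanSpace ℝ (Fin p)) :
    ∃ s, IsBase F Finset.univ s ∧ ∀ β, ∑ k ∈ levelSet w β, s k = F (levelSet w β) := by
  suffices h : ∀ S : Finset (Fin p), ∃ s, IsBase F S s ∧
      ∀ β, ∑ k ∈ S with β ≤ w k, s k = F {k ∈ S | β ≤ w k} from h Finset.univ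
  intro S
  induction S using Finset.induction_on_min_value (f := fun k => w k) with
  | empty => exact ⟨0, ⟨by simp [hF_empty, Finset.subset_empty], by simp [hF_empty]⟩,
      by simp [hF_empty]⟩
  | insert a S ha hmin ih =>
    obtain ⟨s, hs, htight⟩ := ih
    have hs' := hs.update_insert hF ha
    refine ⟨_, hs', fun β => ?_⟩
    by_cases hβ : β ≤ w a
    · have hall : ∀ k ∈ insert a S, β ≤ w k :=
        (Finset.forall_mem_insert _ _ _).2 ⟨hβ, fun k hk => hβ.trans (hmin k hk)⟩
      rw [Finset.filter_true_of_mem hall, hs'.2]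
    · rw [Finset.filter_insert, if_neg hβ, Finset.sum_update_of_notMem (by simp [hβ]), htight]

theorem IsBase.sum_mul_le_lovasz {s : Fin p → ℝ} (hs : IsBase F Finset.univ s)
    (hF_empty : F ∅ = 0) (hF_univ : F Finset.univ = 0) (w : EuclideanSpace ℝ (Fin p)) :
    ∑ k, s k * w k ≤ lovasz F w := by
  have hsum : ∑ k, s k = 0 := hs.2.trans hF_univ
  rw [← lovasz_sum_eq hsum]
  exact lovasz_mono Finset.sum_empty hsum hF_empty hF_univ
    (fun A => hs.1 A (Finset.subset_univ A)) w

theorem convexOn_lovasz (hF : Submodular F) (hF_empty : F ∅ = 0) (hF_univ : F Finset.univ = 0) :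
    ConvexOn ℝ Set.univ (lovasz F) := by
  refine convexOn_univ_of_forall_exists_linear_le fun w => ?_
  obtain ⟨s, hs, htight⟩ := exists_isBase_tight_on_levelSets hF hF_empty w
  have hinner : ∀ x, innerₛₗ ℝ (WithLp.toLp 2 s) x = ∑ k, s k * x k := fun x => by
    simp [PiLp.inner_apply, mul_comm]
  refine ⟨innerₛₗ ℝ (WithLp.toLp 2 s), ?_, fun x => ?_⟩
  · rw [hinner, ← lovasz_sum_eq (hs.2.trans hF_univ)]
    simp only [lovasz, htight]
  · rw [hinner]
    exact hs.sum_mul_le_lovasz hF_empty hF_univ x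

theorem eq_of_isMinOn_proxObjective (hF : Submodular F) (hF_empty : F ∅ = 0)
    (hF_univ : F Finset.univ = 0) (ht : 0 ≤ t) {x y : EuclideanSpace ℝ (Fin p)}
    (hx : IsMinOn (proxObjective F t z) Set.univ x)
    (hy : IsMinOn (proxObjective F t z) Set.univ y) : x = y :=
  (strictConvexOn_half_norm_sub_sq_add ((convexOn_lovasz hF hF_empty hF_univ).smul ht) z)
    |>.eq_of_isMinOn hx hy (Set.mem_univ x) (Set.mem_univ y)

theorem lovasz_eq_add_of_levelSet (hF_empty : F ∅ = 0) (hF_univ : F Finset.univ = 0)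
    {x : EuclideanSpace ℝ (Fin p)} {a b : ℝ} (hab : a ≤ b) {S T : Finset (Fin p)}
    (hw : ∀ β ∈ Set.Ioc a b, levelSet w β = S) (hx : ∀ β ∈ Set.Ioc a b, levelSet x β = T)
    (hout : ∀ β ∉ Set.Ioc a b, levelSet x β = levelSet w β) :
    lovasz F x = lovasz F w + (b - a) * (F T - F S) := by
  have hstep : ∀ β, F (levelSet x β) =
      F (levelSet w β) + (Set.Ioc a b).indicator (fun _ => F T - F S) β := by
    intro β
    by_cases hβ : β ∈ Set.Ioc a b
    · rw [Set.indicator_of_mem hβ, hw β hβ, hx β hβ, add_sub_cancel]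
    · rw [Set.indicator_of_notMem hβ, hout β hβ, add_zero]
  have hind : Integrable ((Set.Ioc a b).indicator fun _ => F T - F S) :=
    (integrable_indicator_iff measurableSet_Ioc).2 (integrableOn_const measure_Ioc_lt_top.ne)
  simp only [lovasz, hstep]
  rw [integral_add (integrable_comp_levelSet hF_empty hF_univ w) hind,
    integral_indicator measurableSet_Ioc, setIntegral_const, Real.volume_real_Ioc_of_le hab,
    smul_eq_mul]

theorem lovasz_add_smul_indicatorVec (hF_empty : F ∅ = 0) (hF_univ : F Finset.univ = 0) {c : ℝ}
    (hc : 0 ≤ c) {C : Finset (Fin p)} (hC : C ⊆ constantSet w α)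
    (hgap : ∀ k, α < w k → α + c ≤ w k) :
    lovasz F (w + c • indicatorVec C) =
      lovasz F w + c * (F (strictLevelSet w α ∪ C) - F (strictLevelSet w α)) := by
  have hval : ∀ k ∈ C, w k = α := fun k hk => mem_constantSet.1 (hC hk)
  have hshift := lovasz_eq_add_of_levelSet (w := w) (x := w + c • indicatorVec C)
    (S := strictLevelSet w α) (T := strictLevelSet w α ∪ C) hF_empty hF_univ
    (le_add_of_nonneg_right hc : α ≤ α + c) ?_ ?_ ?_
  · rwa [add_sub_cancel_left] at hshift
  all_goals
    intro β hβ
    ext k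
    have := hval k
    have := hgap k
    simp only [mem_levelSet, mem_strictLevelSet, Finset.mem_union, add_smul_indicatorVec_apply]
    grind

theorem lovasz_sub_smul_indicatorVec_constantSet (hF_empty : F ∅ = 0) (hF_univ : F Finset.univ = 0)
    {c : ℝ} (hc : 0 ≤ c) (hgap : ∀ k, w k < α → w k ≤ α - c) :
    lovasz F (w + (-c) • indicatorVec (constantSet w α)) =
      lovasz F w + -c * (F (levelSet w α) - F (strictLevelSet w α)) := by
  have hshift := lovasz_eq_add_of_levelSet (w := w)
    (x := w + (-c) • indicatorVec (constantSet w α))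
    (S := levelSet w α) (T := strictLevelSet w α) hF_empty hF_univ
    (sub_le_self α hc) ?_ ?_ ?_
  · rw [hshift]
    ring
  all_goals
    intro β hβ
    ext k
    have := hgap k
    simp only [mem_levelSet, mem_strictLevelSet, mem_constantSet, add_smul_indicatorVec_apply]
    grind

theorem sum_sub_le_of_isMinOn (hF_empty : F ∅ = 0) (hF_univ : F Finset.univ = 0)
    (hw : IsMinOn (proxObjective F t z) Set.univ w) {C : Finset (Fin p)}
    (hC : C ⊆ constantSet w α) :
    ∑ k ∈ C, (z k - α) ≤ t * (F (strictLevelSet w α ∪ C) - F (strictLevelSet w α)) := by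
  have hsum : inner ℝ (z - w) (indicatorVec C) = ∑ k ∈ C, (z k - α) := by
    rw [inner_indicatorVec_right]
    exact Finset.sum_congr rfl fun k hk => by rw [PiLp.sub_apply, mem_constantSet.1 (hC hk)]
  rw [← hsum]
  refine inner_sub_le_of_isMinOn (g := fun x => t * lovasz F x) hw ?_
  filter_upwards [eventually_forall_lt_imp_add_le w α, self_mem_nhdsWithin] with c hgap
    (hc : 0 < c)
  rw [lovasz_add_smul_indicatorVec hF_empty hF_univ hc.le hC hgap]
  ring

theorem le_sum_sub_of_isMinOn (hF_empty : F ∅ = 0) (hF_univ : F Finset.univ = 0)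
    (hw : IsMinOn (proxObjective F t z) Set.univ w) (α : ℝ) :
    t * (F (levelSet w α) - F (strictLevelSet w α)) ≤ ∑ k ∈ constantSet w α, (z k - α) := by
  have hsum : inner ℝ (z - w) (-indicatorVec (constantSet w α)) =
      -∑ k ∈ constantSet w α, (z k - α) := by
    rw [inner_neg_right, inner_indicatorVec_right, neg_inj]
    exact Finset.sum_congr rfl fun k hk => by rw [PiLp.sub_apply, mem_constantSet.1 hk]
  rw [← neg_le_neg_iff, ← hsum]
  refine inner_sub_le_of_isMinOn (g := fun x => t * lovasz F x) hw ?_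
  filter_upwards [eventually_forall_lt_imp_add_le (-w) (-α), self_mem_nhdsWithin] with c hgap
    (hc : 0 < c)
  have hgap' : ∀ k, w k < α → w k ≤ α - c := fun k hk => by
    have := hgap k (by simpa using hk)
    rw [PiLp.neg_apply] at this
    linarith
  rw [smul_neg, ← neg_smul, lovasz_sub_smul_indicatorVec_constantSet hF_empty hF_univ hc.le hgap']
  ring

/- Separability makes the optimality inequalities for `C` and `C'` tight, since their sum is the
reverse of the one for the whole constant set; eliminating `α` leaves a linear equation in `z`. -/
theorem inner_contrast_eq_of_isMinOn (hF_empty : F ∅ = 0) (hF_univ : F Finset.univ = 0)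
    (hw : IsMinOn (proxObjective F t z) Set.univ w) {B C C' : Finset (Fin p)}
    (hB : strictLevelSet w α = B) (hdisj : Disjoint C C') (hunion : C ∪ C' = constantSet w α)
    (hsep : F (B ∪ constantSet w α) - F B = (F (B ∪ C) - F B) + (F (B ∪ C') - F B)) :
    inner ℝ (contrast C C') z =
      t * (C'.card * (F (B ∪ C) - F B) - C.card * (F (B ∪ C') - F B)) := by
  subst hB
  have hC := sum_sub_le_of_isMinOn hF_empty hF_univ hw
    (Finset.subset_union_left.trans hunion.subset)
  have hC' := sum_sub_le_of_isMinOn hF_empty hF_univ hw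
    (Finset.subset_union_right.trans hunion.subset)
  have hall := le_sum_sub_of_isMinOn hF_empty hF_univ hw α
  rw [← strictLevelSet_union_constantSet, hsep, ← hunion, Finset.sum_union hdisj] at hall
  have hC_eq := le_antisymm hC (by linarith)
  have hC'_eq := le_antisymm hC' (by linarith)
  simp only [Finset.sum_sub_distrib, Finset.sum_const, nsmul_eq_mul] at hC_eq hC'_eq
  rw [inner_contrast]
  linear_combination -(C.card : ℝ) * hC'_eq + (C'.card : ℝ) * hC_eq

/-- The lattice of the sets of indices that are closed under passing to a larger value of `w`: the
level sets of `w`, together with `∅` and `V`. -/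
def upperSets (w : EuclideanSpace ℝ (Fin p)) : Set (Finset (Fin p)) :=
  {X | ∀ k ∈ X, ∀ l, w k ≤ w l → l ∈ X}

theorem isSetLattice_upperSets (w : EuclideanSpace ℝ (Fin p)) : IsSetLattice (upperSets w) where
  empty_mem := by simp [upperSets]
  univ_mem := by simp [upperSets]
  union_mem A hA B hB k hk l hl := Finset.mem_union.2 <|
    (Finset.mem_union.1 hk).imp (fun h => hA k h l hl) fun h => hB k h l hl
  inter_mem A hA B hB k hk l hl := Finset.mem_inter.2 <|
    (Finset.mem_inter.1 hk).imp (fun h => hA k h l hl) fun h => hB k h l hl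

theorem levelSet_mem_upperSets (w : EuclideanSpace ℝ (Fin p)) (α : ℝ) :
    levelSet w α ∈ upperSets w := fun k hk l hl => by
  simp only [mem_levelSet] at hk ⊢
  exact hk.trans hl

theorem upperSets_total {A B : Finset (Fin p)} (hA : A ∈ upperSets w) (hB : B ∈ upperSets w) :
    A ⊆ B ∨ B ⊆ A := by
  by_contra! h
  obtain ⟨k, hkA, hkB⟩ := Finset.not_subset.1 h.1
  obtain ⟨l, hlB, hlA⟩ := Finset.not_subset.1 h.2
  rcases le_total (w k) (w l) with hkl | hkl
  exacts [hlA (hA k hkA l hkl), hkB (hB l hlB k hkl)]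

theorem modularOn_upperSets (F : Finset (Fin p) → ℝ) (w : EuclideanSpace ℝ (Fin p)) :
    ModularOn F (upperSets w) := by
  intro A hA B hB
  rcases upperSets_total hA hB with h | h
  · rw [Finset.union_eq_right.2 h, Finset.inter_eq_left.2 h, add_comm]
  · rw [Finset.union_eq_left.2 h, Finset.inter_eq_right.2 h]

theorem forall_mem_upperSets_iff {k l : Fin p} :
    (∀ X ∈ upperSets w, (k ∈ X ↔ l ∈ X)) ↔ w l = w k := by
  refine ⟨fun h => le_antisymm ?_ ?_, fun h X hX =>
    ⟨fun hk => hX k hk l h.ge, fun hl => hX l hl k h.le⟩⟩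
  · simpa using (h _ (levelSet_mem_upperSets w (w l))).2 (by simp)
  · simpa using (h _ (levelSet_mem_upperSets w (w k))).1 (by simp)

theorem blocks_upperSets (w : EuclideanSpace ℝ (Fin p)) :
    blocks (upperSets w) = constantSets w := by
  ext S
  simp only [mem_blocks_iff (isSetLattice_upperSets w), forall_mem_upperSets_iff]
  constructor
  · rintro ⟨k, hk⟩
    exact ⟨⟨k, (hk k).2 rfl⟩, w k, hk⟩
  · rintro ⟨⟨k, hkS⟩, α, hα⟩
    exact ⟨k, fun l => by rw [hα, (hα k).1 hkS]⟩

theorem below_upperSets_constantSet_iff {α' : ℝ} (hne' : (constantSet w α').Nonempty)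
    (hne : (constantSet w α).Nonempty) :
    Below (upperSets w) (constantSet w α') (constantSet w α) ↔ α ≤ α' := by
  obtain ⟨k, hk⟩ := hne'
  obtain ⟨l, hl⟩ := hne
  constructor
  · intro h
    have hk' := h _ (levelSet_mem_upperSets w α) (fun i hi => by simp [mem_constantSet.1 hi]) hk
    rwa [mem_levelSet, mem_constantSet.1 hk] at hk'
  · intro h X hX hsub i hi
    refine hX l (hsub hl) i ?_
    rwa [mem_constantSet.1 hl, mem_constantSet.1 hi]

theorem ancestors_upperSets_constantSet (hne : (constantSet w α).Nonempty) :
    ancestors (upperSets w) (constantSet w α) = strictLevelSet w α := by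
  ext k
  simp only [ancestors, Finset.mem_filter_univ, mem_strictLevelSet, blocks_upperSets]
  constructor
  · rintro ⟨A', hA', hneq, hbelow, hk⟩
    obtain ⟨α', hne', rfl⟩ := mem_constantSets_iff.1 hA'
    rw [mem_constantSet.1 hk]
    exact ((below_upperSets_constantSet_iff hne' hne).1 hbelow).lt_of_ne fun h => hneq (h ▸ rfl)
  · intro hk
    have hkk : k ∈ constantSet w (w k) := mem_constantSet.2 rfl
    refine ⟨_, mem_constantSets_iff.2 ⟨_, ⟨k, hkk⟩, rfl⟩, fun h => ?_,
      (below_upperSets_constantSet_iff ⟨k, hkk⟩ hne).2 hk.le, hkk⟩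
    exact hk.ne' (mem_constantSet.1 (h ▸ hkk))

theorem mem_openFaceCone_of_upperSets_subset {D : Set (Finset (Fin p))}
    (hblocks : blocks D = constantSets w) (hD : upperSets w ⊆ D) : w ∈ openFaceCone D := by
  simp only [openFaceCone, hblocks, Set.mem_ofPred_eq, mem_constantSets_iff]
  constructor
  · rintro _ ⟨α, -, rfl⟩ k hk l hl
    rw [mem_constantSet.1 hk, mem_constantSet.1 hl]
  · rintro _ ⟨α', hne', rfl⟩ _ ⟨α, hne, rfl⟩ hneq hbelow k hk l hl
    have hle := (below_upperSets_constantSet_iff hne' hne).1 fun X hX => hbelow X (hD hX)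
    rw [mem_constantSet.1 hk, mem_constantSet.1 hl]
    exact hle.lt_of_ne fun h => hneq (h ▸ rfl)

theorem exists_isFaceLattice_superset {D₀ : Set (Finset (Fin p))} (hD₀ : IsSetLattice D₀)
    (hmod : ModularOn F D₀) (hinsep : BlocksInseparable F D₀) :
    ∃ D, D₀ ⊆ D ∧ IsFaceLattice F D ∧ blocks D = blocks D₀ := by
  obtain ⟨D, hle, hD⟩ := (Set.toFinite {D' | IsSetLattice D' ∧ blocks D' = blocks D₀ ∧
    ModularOn F D' ∧ BlocksInseparable F D'}).exists_le_maximal ⟨hD₀, rfl, hmod, hinsep⟩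
  have hblocks : blocks D = blocks D₀ := hD.prop.2.1
  refine ⟨D, hle, ?_, hblocks⟩
  rw [IsFaceLattice, hblocks]
  exact hD

theorem ae_forall_inner_contrast_ne (r : Finset (Fin p) → Finset (Fin p) → Finset (Fin p) → ℝ) :
    ∀ᵐ z : EuclideanSpace ℝ (Fin p), ∀ B C C', C.Nonempty → C'.Nonempty → Disjoint C C' →
      inner ℝ (contrast C C') z ≠ r B C C' := by
  simp only [ae_all_iff]
  exact fun B C C' hC hC' hdisj => ae_inner_ne volume (contrast_ne_zero hC hC' hdisj) _

theorem ae_blocksInseparable_upperSets_of_isMinOn (hF_empty : F ∅ = 0)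
    (hF_univ : F Finset.univ = 0) (t : ℝ) :
    ∀ᵐ z : EuclideanSpace ℝ (Fin p), ∀ w, IsMinOn (proxObjective F t z) Set.univ w →
      BlocksInseparable F (upperSets w) := by
  filter_upwards [ae_forall_inner_contrast_ne fun B C C' =>
    t * (C'.card * (F (B ∪ C) - F B) - C.card * (F (B ∪ C') - F B))] with z hz w hw A hA
  rw [blocks_upperSets, mem_constantSets_iff] at hA
  obtain ⟨α, hne, rfl⟩ := hA
  rw [ancestors_upperSets_constantSet hne]
  rintro ⟨C, C', hC, hC', hdisj, hunion, hsep⟩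
  exact hz _ C C' hC hC' hdisj
    (inner_contrast_eq_of_isMinOn hF_empty hF_univ hw rfl hdisj hunion hsep)

end LovaszProx

open LovaszProx in
theorem proposition6_general {p : ℕ} {F : Finset (Fin p) → ℝ} (hF_empty : F ∅ = 0)
    (hF_univ : F Finset.univ = 0) (t : ℝ) {Ω : Type*} [MeasurableSpace Ω] (P : Measure Ω)
    (Z : Ω → EuclideanSpace ℝ (Fin p)) (hZ : HasPDF Z P volume) :
    (∀ z, ∃ w, IsMinOn (proxObjective F t z) Set.univ w) ∧
    ∀ᵐ ω ∂P, ∀ w, IsMinOn (proxObjective F t (Z ω)) Set.univ w →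
      ∃ D, IsFaceLattice F D ∧ w ∈ openFaceCone D ∧ constantSets w = blocks D := by
  refine ⟨exists_isMinOn_proxObjective hF_empty hF_univ t, ?_⟩
  have hinsep := (HasPDF.absolutelyContinuous (X := Z) (ℙ := P)).ae_le
    (ae_blocksInseparable_upperSets_of_isMinOn hF_empty hF_univ t)
  filter_upwards [ae_of_ae_map (HasPDF.aemeasurable Z P volume) hinsep] with ω hω w hw
  obtain ⟨D, hsub, hface, hblocks⟩ := exists_isFaceLattice_superset (isSetLattice_upperSets w)
    (modularOn_upperSets F w) (hω w hw)
  rw [blocks_upperSets] at hblocks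
  exact ⟨D, hface, mem_openFaceCone_of_upperSets_subset hblocks hsub, hblocks.symm⟩

theorem proposition6 {p : ℕ} (F : Finset (Fin p) → ℝ) (hF : LovaszProx.Submodular F)
    (hF_empty : F ∅ = 0) (hF_univ : F Finset.univ = 0) (t : ℝ) (ht : 0 ≤ t)
    {Ω : Type*} [MeasurableSpace Ω] (P : MeasureTheory.Measure Ω)
    [MeasureTheory.IsProbabilityMeasure P] (Z : Ω → EuclideanSpace ℝ (Fin p))
    (hZ : MeasureTheory.HasPDF Z P MeasureTheory.volume) :
    (∀ z, ∃! w, IsMinOn (LovaszProx.proxObjective F t z) Set.univ w) ∧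
    ∀ᵐ ω ∂P, ∀ w, IsMinOn (LovaszProx.proxObjective F t (Z ω)) Set.univ w →
      ∃ D : Set (Finset (Fin p)), LovaszProx.IsFaceLattice F D ∧
        w ∈ LovaszProx.openFaceCone D ∧
        LovaszProx.constantSets w = LovaszProx.blocks D :=
  let ⟨hexists, hface⟩ := proposition6_general hF_empty hF_univ t P Z hZ
  ⟨fun z => (hexists z).imp fun _ hw =>
    ⟨hw, fun _ hx => LovaszProx.eq_of_isMinOn_proxObjective hF hF_empty hF_univ ht hx hw⟩, hface⟩
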